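/- Restricted Dicartesian Coherence II. Let ${\cal L}$ be a set of propositional letters, and let formulae be built from the letters and the constants $\mathrm{I}$, $\mathrm{O}$ with the binary connectives $\times$ and $+$. Let ${\cal D}$ be the free dicartesian category generated by ${\cal L}$: its objects are the formulae, and its arrows $A\to B$ are equivalence classes of terms. Terms are generated from ${\bf 1}_A:A\to A$, $k_A:A\to\mathrm{I}$, $l_A:\mathrm{O}\to A$, $k^1_{A,B}:A\times B\to A$, $k^2_{A,B}:A\times B\to B$, $w_A:A\to A\times A$, $l^1_{A,B}:A\to A+B$, $l^2_{A,B}:B\to A+B$, $m_A:A+A\to A$ by composition and by the operations $f\times g:A\times C\to B\times D$ and $f+g:A+C\to B+D$ on $f:A\to B$, $g:C\to D$. Two terms are equal in ${\cal D}$ iff this follows from the equations of bicartesian categories (categories with all finite products and finite coproducts; $\mathrm{I}$ is terminal, $\mathrm{O}$ is initial, $k^i$, $l^i$ are the projections and injections, $w_A$, $m_A$ the diagonal and codiagonal) together with $$(k\mathrm{O})\quad k^1_{\mathrm{O},\mathrm{O}}=k^2_{\mathrm{O},\mathrm{O}},\qquad (l\mathrm{I})\quad l^1_{\mathrm{I},\mathrm{I}}=l^2_{\mathrm{I},\mathrm{I}}.$$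 Let ${\cal G}$ be the category whose objects are the finite ordinals and whose arrows $n\to m$ are the binary relations $R\subseteq n\times m$, with composition of relations. Let $|A|$ be the number of occurrences of letters in $A$. The functor $G:{\cal D}\to{\cal G}$ is defined by $G(A)=|A|$ and $G({\bf 1}_A)=G(k^1_{A,B})=G(l^1_{A,B})=\{(x,x):x\in|A|\}$, $G(k^2_{A,B})=\{(x+|A|,x):x\in|B|\}$, $G(l^2_{A,B})=\{(x,x+|A|):x\in|B|\}$, $G(w_A)=\{(x,x):x\in|A|\}\cup\{(x,x+|A|):x\in|A|\}$, $G(m_A)=\{(x,x):x\in|A|\}\cup\{(x+|A|,x):x\in|A|\}$, $G(k_A)=G(l_A)=\emptyset$, $G(g\circ f)=G(g)\circ G(f)$, and, for $f:A\to B$ and $g:C\to D$, $G(f\times g)=G(f+g)=G(f)\cup\{(x+|A|,y+|B|):(x,y)\in G(g)\}$. A formula $C$ is a contradiction if there is an arrow $C\to\mathrm{O}$ in ${\cal D}$, and a tautology if there is an arrow $\mathrm{I}\to C$ in ${\cal D}$. A formula is $\mathrm{O}$-normal if for every subformula $D\times C$ or $C\times D$ of it with $C$ a contradiction there is no occurrence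 of $+$ in $D$; it is $\mathrm{I}$-normal if for every subformula $D+C$ or $C+D$ of it with $C$ a tautology there is no occurrence of $\times$ in $D$. (Every formula is a subformula of itself.) If $f,g:A\to B$ are terms of ${\cal D}$ such that $G(f)=G(g)$, and either $A$ is $\mathrm{O}$-normal or $B$ is $\mathrm{I}$-normal, then $f=g$ in ${\cal D}$. -/

import Mathlib

open CategoryTheory

universe u

namespace Dicartesian

/-- The propositional language generated by a set `L` of propositional letters, with the
constants `I`, `O` and the binary connectives `×` (`prod`) and `+` (`sum`). -/
inductive Formula (L : Type u) : Type u
  | letter : L → Formula L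
  | I : Formula L
  | O : Formula L
  | prod : Formula L → Formula L → Formula L
  | sum : Formula L → Formula L → Formula L

variable {L : Type u}

namespace Formula

/-- The number `|A|` of occurrences of propositional letters in `A`. -/
def size : Formula L → ℕ
  | letter _ => 1
  | I => 0
  | O => 0
  | prod A B => A.size + B.size
  | sum A B => A.size + B.size

/-- `Subformula C A`: the formula `C` is a subformula of `A` (`A` itself included). -/
inductive Subformula : Formula L → Formula L → Prop
  | refl (A : Formula L) : Subformula A A
  | prod_left {C A B : Formula L} : Subformula C A → Subformula C (prod A B)
  | prod_right {C A B : Formula L} : Subformula C B → Subformula C (prod A B)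
  | sum_left {C A B : Formula L} : Subformula C A → Subformula C (sum A B)
  | sum_right {C A B : Formula L} : Subformula C B → Subformula C (sum A B)

/-- The connective `×` occurs in the formula. -/
def ProdOccurs : Formula L → Prop
  | letter _ => False
  | I => False
  | O => False
  | prod _ _ => True
  | sum A B => A.ProdOccurs ∨ B.ProdOccurs

/-- The connective `+` occurs in the formula. -/
def SumOccurs : Formula L → Prop
  | letter _ => False
  | I => False
  | O => False
  | prod A B => A.SumOccurs ∨ B.SumOccurs
  | sum _ _ => True

end Formula

open Formula

/-- Terms of type `(A, B)`. The term `comp g f` is `g ∘ f`, `times f g` is `f × g`, and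
`plus f g` is `f + g`. -/
inductive Term {L : Type u} : Formula L → Formula L → Type u
  | one (A : Formula L) : Term A A
  | k (A : Formula L) : Term A I
  | k1 (A B : Formula L) : Term (prod A B) A
  | k2 (A B : Formula L) : Term (prod A B) B
  | w (A : Formula L) : Term A (prod A A)
  | l (A : Formula L) : Term O A
  | l1 (A B : Formula L) : Term A (sum A B)
  | l2 (A B : Formula L) : Term B (sum A B)
  | m (A : Formula L) : Term (sum A A) A
  | comp {A B C : Formula L} (g : Term B C) (f : Term A B) : Term A C
  | times {A B C D : Formula L} (f : Term A B) (g : Term C D) : Term (prod A C) (prod B D)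
  | plus {A B C D : Formula L} (f : Term A B) (g : Term C D) : Term (sum A C) (sum B D)

open Term

/-- Equality of terms in the free dicartesian category: the least congruence that satisfies
the equations of bicartesian categories together with `(kO)` and `(lI)`. -/
inductive TermEq {L : Type u} : ∀ {A B : Formula L}, Term A B → Term A B → Prop
  -- equivalence relation
  | refl {A B : Formula L} (f : Term A B) : TermEq f f
  | symm {A B : Formula L} {f g : Term A B} : TermEq f g → TermEq g f
  | trans {A B : Formula L} {f g h : Term A B} : TermEq f g → TermEq g h → TermEq f h
  -- congruence
  | comp_congr {A B C : Formula L} {g g' : Term B C} {f f' : Term A B} :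
      TermEq g g' → TermEq f f' → TermEq (comp g f) (comp g' f')
  | times_congr {A B C D : Formula L} {f f' : Term A B} {g g' : Term C D} :
      TermEq f f' → TermEq g g' → TermEq (times f g) (times f' g')
  | plus_congr {A B C D : Formula L} {f f' : Term A B} {g g' : Term C D} :
      TermEq f f' → TermEq g g' → TermEq (plus f g) (plus f' g')
  -- categorial equations
  | one_comp {A B : Formula L} (f : Term A B) : TermEq (comp (one B) f) f
  | comp_one {A B : Formula L} (f : Term A B) : TermEq (comp f (one A)) f
  | assoc {A B C D : Formula L} (h : Term C D) (g : Term B C) (f : Term A B) :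
      TermEq (comp h (comp g f)) (comp (comp h g) f)
  -- product equations
  | times_one (A B : Formula L) : TermEq (times (one A) (one B)) (one (prod A B))
  | times_comp {A₁ B₁ C₁ A₂ B₂ C₂ : Formula L} (g₁ : Term B₁ C₁) (g₂ : Term A₁ B₁)
      (f₁ : Term B₂ C₂) (f₂ : Term A₂ B₂) :
      TermEq (times (comp g₁ g₂) (comp f₁ f₂)) (comp (times g₁ f₁) (times g₂ f₂))
  | k1_nat {A₁ A₂ B₁ B₂ : Formula L} (f₁ : Term A₁ B₁) (f₂ : Term A₂ B₂) :
      TermEq (comp (k1 B₁ B₂) (times f₁ f₂)) (comp f₁ (k1 A₁ A₂))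
  | k2_nat {A₁ A₂ B₁ B₂ : Formula L} (f₁ : Term A₁ B₁) (f₂ : Term A₂ B₂) :
      TermEq (comp (k2 B₁ B₂) (times f₁ f₂)) (comp f₂ (k2 A₁ A₂))
  | w_nat {A B : Formula L} (f : Term A B) : TermEq (comp (w B) f) (comp (times f f) (w A))
  | k1_w (A : Formula L) : TermEq (comp (k1 A A) (w A)) (one A)
  | k2_w (A : Formula L) : TermEq (comp (k2 A A) (w A)) (one A)
  | times_k1_k2_w (A B : Formula L) :
      TermEq (comp (times (k1 A B) (k2 A B)) (w (prod A B))) (one (prod A B))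
  | k_unique {A : Formula L} (f : Term A I) : TermEq f (k A)
  | kO : TermEq (k1 O O) (k2 O O)
  -- sum equations
  | plus_one (A B : Formula L) : TermEq (plus (one A) (one B)) (one (sum A B))
  | plus_comp {A₁ B₁ C₁ A₂ B₂ C₂ : Formula L} (g₁ : Term B₁ C₁) (g₂ : Term A₁ B₁)
      (f₁ : Term B₂ C₂) (f₂ : Term A₂ B₂) :
      TermEq (plus (comp g₁ g₂) (comp f₁ f₂)) (comp (plus g₁ f₁) (plus g₂ f₂))
  | l1_nat {A₁ A₂ B₁ B₂ : Formula L} (f₁ : Term A₁ B₁) (f₂ : Term A₂ B₂) :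
      TermEq (comp (plus f₁ f₂) (l1 A₁ A₂)) (comp (l1 B₁ B₂) f₁)
  | l2_nat {A₁ A₂ B₁ B₂ : Formula L} (f₁ : Term A₁ B₁) (f₂ : Term A₂ B₂) :
      TermEq (comp (plus f₁ f₂) (l2 A₁ A₂)) (comp (l2 B₁ B₂) f₂)
  | m_nat {A B : Formula L} (f : Term A B) : TermEq (comp f (m A)) (comp (m B) (plus f f))
  | m_l1 (A : Formula L) : TermEq (comp (m A) (l1 A A)) (one A)
  | m_l2 (A : Formula L) : TermEq (comp (m A) (l2 A A)) (one A)
  | m_plus_l1_l2 (A B : Formula L) :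
      TermEq (comp (m (sum A B)) (plus (l1 A B) (l2 A B))) (one (sum A B))
  | l_unique {A : Formula L} (f : Term O A) : TermEq f (l A)
  | lI : TermEq (l1 I I) (l2 I I)

/-- Equality of terms in the free dicartesian category, as a setoid. -/
def termSetoid (A B : Formula L) : Setoid (Term A B) where
  r := TermEq
  iseqv := ⟨TermEq.refl, TermEq.symm, TermEq.trans⟩

/-- The free dicartesian category generated by `L`: its objects are the formulae, its arrows
are the equivalence classes of terms. -/
instance freeDicartesian : Category.{u} (Formula L) where
  Hom A B := Quotient (termSetoid A B)
  id A := Quotient.mk _ (one A)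
  comp {A B C} f g :=
    Quotient.map₂ (sa := termSetoid A B) (sb := termSetoid B C) (sc := termSetoid A C)
      (fun f g => comp g f) (fun _ _ hf _ _ hg => TermEq.comp_congr hg hf) f g
  id_comp f := Quotient.inductionOn f fun f => Quotient.sound (TermEq.comp_one f)
  comp_id f := Quotient.inductionOn f fun f => Quotient.sound (TermEq.one_comp f)
  assoc f g h := Quotient.inductionOn₃ f g h fun f g h => Quotient.sound (TermEq.assoc h g f)

/-- The arrow of the free dicartesian category for which a term stands. -/
def Term.arrow {A B : Formula L} (f : Term A B) : A ⟶ B :=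
  Quotient.mk (termSetoid A B) f

/-- The objects of the graphical category: finite ordinals. -/
structure GraphObj where
  card : ℕ

/-- The arrows from `n` to `m` of the graphical category: the subsets of `n × m`, where a
finite ordinal is the set of all smaller ones. -/
@[ext]
structure GraphHom (n m : GraphObj) where
  rel : Set (ℕ × ℕ)
  bound : ∀ p ∈ rel, p.1 < n.card ∧ p.2 < m.card

/-- The composition `S ∘ R` of binary relations. -/
def relComp (S R : Set (ℕ × ℕ)) : Set (ℕ × ℕ) :=
  {p | ∃ y, (p.1, y) ∈ R ∧ (y, p.2) ∈ S}

/-- The graphical category: the identity of `n` is the identity relation on `n`, and composition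
is composition of relations. -/
instance graphicalCategory : Category.{0} GraphObj where
  Hom := GraphHom
  id n := ⟨{p | p.1 < n.card ∧ p.2 = p.1}, fun _ h => ⟨h.1, h.2 ▸ h.1⟩⟩
  comp R S := ⟨relComp S.rel R.rel,
    fun _ ⟨_, hR, hS⟩ => ⟨(R.bound _ hR).1, (S.bound _ hS).2⟩⟩
  id_comp {n m} R := GraphHom.ext <| Set.ext fun ⟨x, z⟩ => by
    constructor
    · rintro ⟨y, ⟨_, h'⟩, h⟩
      obtain rfl : y = x := h'
      exact h
    · exact fun h => ⟨x, ⟨(R.bound _ h).1, rfl⟩, h⟩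
  comp_id {n m} R := GraphHom.ext <| Set.ext fun ⟨x, z⟩ => by
    constructor
    · rintro ⟨y, h, ⟨_, h'⟩⟩
      obtain rfl : z = y := h'
      exact h
    · exact fun h => ⟨z, h, (R.bound _ h).2, rfl⟩
  assoc R S T := GraphHom.ext <| Set.ext fun ⟨x, z⟩ => by
    constructor
    · rintro ⟨y, ⟨y', h₁, h₂⟩, h₃⟩
      exact ⟨y', h₁, y, h₂, h₃⟩
    · rintro ⟨y', h₁, y, h₂, h₃⟩
      exact ⟨y, ⟨y', h₁, h₂⟩, h₃⟩

/-- The relation `R ∪ {(x + a, y + b) : (x, y) ∈ S}`. -/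
def juxtapose (a b : ℕ) (R S : Set (ℕ × ℕ)) : Set (ℕ × ℕ) :=
  R ∪ {p | ∃ x y, (x, y) ∈ S ∧ p = (x + a, y + b)}

/-- The set of ordered pairs `G(f)` assigned to a term `f`. -/
def Term.graph : ∀ {A B : Formula L}, Term A B → Set (ℕ × ℕ)
  | _, _, one A => {p | ∃ x < A.size, p = (x, x)}
  | _, _, k1 A _ => {p | ∃ x < A.size, p = (x, x)}
  | _, _, k2 A B => {p | ∃ x < B.size, p = (x + A.size, x)}
  | _, _, w A => {p | ∃ x < A.size, p = (x, x)} ∪ {p | ∃ x < A.size, p = (x, x + A.size)}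
  | _, _, k _ => ∅
  | _, _, l1 A _ => {p | ∃ x < A.size, p = (x, x)}
  | _, _, l2 A B => {p | ∃ x < B.size, p = (x, x + A.size)}
  | _, _, m A => {p | ∃ x < A.size, p = (x, x)} ∪ {p | ∃ x < A.size, p = (x + A.size, x)}
  | _, _, l _ => ∅
  | _, _, comp g f => relComp g.graph f.graph
  | _, _, times (A := A) (B := B) f g => juxtapose A.size B.size f.graph g.graph
  | _, _, plus (A := A) (B := B) f g => juxtapose A.size B.size f.graph g.graph

theorem Term.graph_bound {A B : Formula L} (f : Term A B) :
    ∀ x y, (x, y) ∈ f.graph → x < A.size ∧ y < B.size := by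
  induction f with
  | comp g f ihg ihf =>
    rintro x y ⟨z, h₁, h₂⟩
    exact ⟨(ihf _ _ h₁).1, (ihg _ _ h₂).2⟩
  | times f g ihf ihg | plus f g ihf ihg =>
    simp only [Formula.size]
    rintro x y (h | ⟨x', y', h, he⟩)
    · have := ihf _ _ h
      omega
    · have := ihg _ _ h
      simp only [Prod.mk.injEq] at he
      omega
  | _ => simp [Term.graph, Formula.size] <;> omega

theorem relComp_assoc (T S R : Set (ℕ × ℕ)) :
    relComp T (relComp S R) = relComp (relComp T S) R := by
  ext ⟨x, z⟩
  constructor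
  · rintro ⟨y, ⟨y', h₁, h₂⟩, h₃⟩
    exact ⟨y', h₁, y, h₂, h₃⟩
  · rintro ⟨y', h₁, y, h₂, h₃⟩
    exact ⟨y, ⟨y', h₁, h₂⟩, h₃⟩

theorem relComp_juxtapose {a b c : ℕ} {R R' S S' : Set (ℕ × ℕ)}
    (hR : ∀ x y, (x, y) ∈ R → x < a ∧ y < b) (hS : ∀ x y, (x, y) ∈ S → x < b ∧ y < c) :
    juxtapose a c (relComp S R) (relComp S' R') =
      relComp (juxtapose b c S S') (juxtapose a b R R') := by
  ext ⟨x, z⟩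
  constructor
  · rintro (⟨y, h₁, h₂⟩ | ⟨x', z', ⟨y, h₁, h₂⟩, he⟩)
    · exact ⟨y, Or.inl h₁, Or.inl h₂⟩
    · cases he
      exact ⟨y + b, Or.inr ⟨_, _, h₁, rfl⟩, Or.inr ⟨_, _, h₂, rfl⟩⟩
  · rintro ⟨y, h₁ | ⟨x', y', h₁, he⟩, h₂ | ⟨y'', z', h₂, he'⟩⟩
    · exact Or.inl ⟨y, h₁, h₂⟩
    · have := hR _ _ h₁
      simp only [Prod.mk.injEq] at he'
      omega
    · have := hS _ _ h₂
      simp only [Prod.mk.injEq] at he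
      omega
    · simp only [Prod.mk.injEq] at he he'
      obtain ⟨rfl, rfl⟩ := he
      obtain ⟨he', rfl⟩ := he'
      obtain rfl : y' = y'' := by omega
      exact Or.inr ⟨_, _, ⟨_, h₁, h₂⟩, rfl⟩

theorem mem_juxtapose {a b : ℕ} {R S : Set (ℕ × ℕ)} {x y : ℕ} :
    (x, y) ∈ juxtapose a b R S ↔ (x, y) ∈ R ∨ (a ≤ x ∧ b ≤ y ∧ (x - a, y - b) ∈ S) := by
  refine or_congr Iff.rfl ⟨?_, fun ⟨hx, hy, h⟩ => ⟨_, _, h, ?_⟩⟩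
  · rintro ⟨x', y', h, he⟩
    cases he
    simpa using h
  · rw [Nat.sub_add_cancel hx, Nat.sub_add_cancel hy]

theorem mem_relComp {S R : Set (ℕ × ℕ)} {x z : ℕ} :
    (x, z) ∈ relComp S R ↔ ∃ y, (x, y) ∈ R ∧ (y, z) ∈ S := Iff.rfl

theorem mem_graph_one {A : Formula L} {x y : ℕ} :
    (x, y) ∈ (one A).graph ↔ y = x ∧ x < A.size := by
  simp [Term.graph]; grind

theorem mem_graph_k1 {A B : Formula L} {x y : ℕ} :
    (x, y) ∈ (k1 A B).graph ↔ y = x ∧ x < A.size := by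
  simp [Term.graph]; grind

theorem mem_graph_k2 {A B : Formula L} {x y : ℕ} :
    (x, y) ∈ (k2 A B).graph ↔ x = y + A.size ∧ y < B.size := by
  simp [Term.graph]; grind

theorem mem_graph_w {A : Formula L} {x y : ℕ} :
    (x, y) ∈ (w A).graph ↔ (y = x ∨ y = x + A.size) ∧ x < A.size := by
  simp [Term.graph]; grind

theorem mem_graph_l1 {A B : Formula L} {x y : ℕ} :
    (x, y) ∈ (l1 A B).graph ↔ y = x ∧ x < A.size := by
  simp [Term.graph]; grind

theorem mem_graph_l2 {A B : Formula L} {x y : ℕ} :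
    (x, y) ∈ (l2 A B).graph ↔ y = x + A.size ∧ x < B.size := by
  simp [Term.graph]; grind

theorem mem_graph_m {A : Formula L} {x y : ℕ} :
    (x, y) ∈ (m A).graph ↔ (x = y ∨ x = y + A.size) ∧ y < A.size := by
  simp [Term.graph]; grind

theorem mem_graph_comp {A B C : Formula L} {g : Term B C} {f : Term A B} {x z : ℕ} :
    (x, z) ∈ (comp g f).graph ↔ ∃ y, (x, y) ∈ f.graph ∧ (y, z) ∈ g.graph := Iff.rfl

theorem mem_graph_times {A B C D : Formula L} {f : Term A B} {g : Term C D} {x y : ℕ} :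
    (x, y) ∈ (times f g).graph ↔
      (x, y) ∈ f.graph ∨ (A.size ≤ x ∧ B.size ≤ y ∧ (x - A.size, y - B.size) ∈ g.graph) :=
  mem_juxtapose

theorem mem_graph_plus {A B C D : Formula L} {f : Term A B} {g : Term C D} {x y : ℕ} :
    (x, y) ∈ (plus f g).graph ↔
      (x, y) ∈ f.graph ∨ (A.size ≤ x ∧ B.size ≤ y ∧ (x - A.size, y - B.size) ∈ g.graph) :=
  mem_juxtapose

/-- Equal terms are assigned the same relation. -/
theorem TermEq.graph_eq {A B : Formula L} {f g : Term A B} (h : TermEq f g) :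
    f.graph = g.graph := by
  induction h with
  | refl => rfl
  | symm _ ih => exact ih.symm
  | trans _ _ ih₁ ih₂ => exact ih₁.trans ih₂
  | comp_congr _ _ ih₁ ih₂ | times_congr _ _ ih₁ ih₂ | plus_congr _ _ ih₁ ih₂ =>
    simp only [Term.graph, ih₁, ih₂]
  | assoc h g f => exact relComp_assoc _ _ _
  | times_comp g₁ g₂ f₁ f₂ | plus_comp g₁ g₂ f₁ f₂ =>
    exact relComp_juxtapose g₂.graph_bound g₁.graph_bound
  | k_unique f | l_unique f =>
    ext ⟨x, y⟩
    exact ⟨fun h => by have := f.graph_bound x y h; simp [Formula.size] at this, False.elim⟩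
  | m_nat f =>
    have hf := f.graph_bound
    ext ⟨x, y⟩
    simp only [mem_graph_m, mem_graph_comp, mem_graph_plus]
    constructor
    · rintro ⟨z, ⟨rfl | rfl, hz⟩, h⟩
      · exact ⟨y, Or.inl h, Or.inl rfl, (hf _ _ h).2⟩
      · refine ⟨y + _, Or.inr ⟨Nat.le_add_left _ _, Nat.le_add_left _ _, ?_⟩, Or.inr rfl,
          (hf _ _ h).2⟩
        simpa using h
    · rintro ⟨z, h | ⟨hx, hz, h⟩, rfl | rfl, hy⟩
      · exact ⟨x, ⟨Or.inl rfl, (hf _ _ h).1⟩, h⟩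
      · have := (hf _ _ h).2
        omega
      · omega
      · rw [Nat.add_sub_cancel] at h
        exact ⟨_, ⟨Or.inr (Nat.sub_add_cancel hx).symm, (hf _ _ h).1⟩, h⟩
  | m_plus_l1_l2 A B =>
    ext ⟨x, y⟩
    simp only [mem_graph_one, mem_graph_l1, mem_graph_l2, mem_graph_m, mem_graph_comp,
      mem_graph_plus, Formula.size]
    constructor
    · rintro ⟨z, h, h'⟩
      omega
    · rintro ⟨rfl, h⟩
      by_cases hA : y < A.size
      · exact ⟨y, by omega, by omega⟩
      · exact ⟨y + (A.size + B.size), by omega, by omega⟩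
  | k2_w A =>
    ext ⟨x, y⟩
    simp only [mem_graph_one, mem_graph_k2, mem_graph_w, mem_graph_comp]
    constructor
    · rintro ⟨z, h, h'⟩
      omega
    · exact fun h => ⟨x + A.size, by omega, by omega⟩
  | m_l2 A =>
    ext ⟨x, y⟩
    simp only [mem_graph_one, mem_graph_l2, mem_graph_m, mem_graph_comp]
    constructor
    · rintro ⟨z, h, h'⟩
      omega
    · exact fun h => ⟨x + A.size, by omega, by omega⟩
  | times_k1_k2_w A B =>
    ext ⟨x, y⟩
    simp only [mem_graph_one, mem_graph_k1, mem_graph_k2, mem_graph_w, mem_graph_comp,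
      mem_graph_times, Formula.size]
    constructor
    · rintro ⟨z, h, h'⟩
      omega
    · rintro ⟨rfl, h⟩
      by_cases hA : y < A.size
      · exact ⟨y, by omega, by omega⟩
      · exact ⟨y + (A.size + B.size), by omega, by omega⟩
  | one_comp f | comp_one f | w_nat f =>
    have hf := f.graph_bound
    ext ⟨x, y⟩
    simp [mem_graph_one, mem_graph_w, mem_graph_comp, mem_graph_times, and_assoc,
      or_and_right, exists_or]
    grind
  | k1_nat f g | k2_nat f g | l1_nat f g | l2_nat f g =>
    have hf := f.graph_bound
    have hg := g.graph_bound
    ext ⟨x, y⟩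
    simp [mem_graph_k1, mem_graph_k2, mem_graph_l1, mem_graph_l2, mem_graph_comp,
      mem_graph_times, mem_graph_plus, and_assoc, or_and_right, exists_or]
    grind
  | kO | lI =>
    ext ⟨x, y⟩
    simp [mem_graph_k1, mem_graph_k2, mem_graph_l1, mem_graph_l2, Formula.size]
  | _ =>
    ext ⟨x, y⟩
    simp only [mem_graph_one, mem_graph_k1, mem_graph_w, mem_graph_l1, mem_graph_m, mem_graph_comp,
      mem_graph_times, mem_graph_plus, Formula.size]
    constructor
    · intro h
      omega
    · rintro h
      first | omega | exact ⟨x, by omega, by omega⟩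

/-- The functor `G` from the free dicartesian category to the graphical category. -/
def G : Formula L ⥤ GraphObj where
  obj A := ⟨A.size⟩
  map {A B} f := Quotient.lift (s := termSetoid A B)
    (fun f => (⟨f.graph, fun p h => f.graph_bound p.1 p.2 h⟩ : GraphHom ⟨A.size⟩ ⟨B.size⟩))
    (fun _ _ h => GraphHom.ext (TermEq.graph_eq h)) f
  map_id _ := GraphHom.ext <| Set.ext fun ⟨_, _⟩ => mem_graph_one.trans and_comm
  map_comp f g := Quotient.inductionOn₂ f g fun _ _ => rfl

/-- A formula is a contradiction when there is an arrow from it to `O`. -/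
def IsContradiction (C : Formula L) : Prop :=
  Nonempty (C ⟶ O)

/-- A formula is a tautology when there is an arrow from `I` to it. -/
def IsTautology (C : Formula L) : Prop :=
  Nonempty (I ⟶ C)

/-- `A` is `O`-normal: for every subformula `D × C` or `C × D` of `A` with `C` a contradiction,
there is no occurrence of `+` in `D`. -/
def ONormal (A : Formula L) : Prop :=
  ∀ C D : Formula L, (Subformula (prod D C) A ∨ Subformula (prod C D) A) →
    IsContradiction C → ¬ D.SumOccurs

/-- `A` is `I`-normal: for every subformula `D + C` or `C + D` of `A` with `C` a tautology,
there is no occurrence of `×` in `D`. -/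
def INormal (A : Formula L) : Prop :=
  ∀ C D : Formula L, (Subformula (sum D C) A ∨ Subformula (sum C D) A) →
    IsTautology C → ¬ D.ProdOccurs

end Dicartesian

/-! The proof combines cut elimination with induction on the sizes of source and target. Every arrow
is denoted by a cut-free term (`CutFree.exists_hom`), so one may inspect its last rule.

An arrow with empty relation factors through `O` or through `I` (`isNull_of_not_linked`). The
equations (kO) and (lI) make any two such arrows with the same source and target equal
(`IsNull.unique`); this settles the case without links.

Let two arrows share a nonempty relation. A sum as source or a product as target is removed by its
universal property. If both arrows start with a projection, or both end with an injection, a common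
link forces the same side, and what remains is smaller. The crossed case is `proj b ≫ f = g ≫ inj
c`, from a product to a sum (`proj_comp_eq_comp_inj`). It is enough that `g` factors through `proj
b` or `f` through `inj c`, since the induction hypothesis then gives the equality.

Normality supplies such a factorization. If the factor discarded by `proj b` is not a contradiction,
`g` factors. If it is one, `O`-normality leaves no `+` in the other factor, so the cut-free term for
`f` contains no copairing, and `f` factors. `I`-normality of the target works dually. -/

namespace Dicartesian

variable {L : Type u}

open Formula Term

/-! ### Universal properties of products, sums, `I` and `O`. -/

section Structure

variable {A B C D : Formula L}

/-- The pairing of two arrows with a common source. -/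
def pair (f : C ⟶ A) (g : C ⟶ B) : C ⟶ prod A B :=
  Quotient.map₂ (sa := termSetoid C A) (sb := termSetoid C B) (sc := termSetoid C (prod A B))
    (fun f g => comp (times f g) (w C))
    (fun _ _ hf _ _ hg => .comp_congr (.times_congr hf hg) (.refl _)) f g

/-- The copairing of two arrows with a common target. -/
def copair (f : A ⟶ C) (g : B ⟶ C) : sum A B ⟶ C :=
  Quotient.map₂ (sa := termSetoid A C) (sb := termSetoid B C) (sc := termSetoid (sum A B) C)
    (fun f g => comp (m C) (plus f g))
    (fun _ _ hf _ _ hg => .comp_congr (.refl _) (.plus_congr hf hg)) f g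

/-- The first of two formulae for `false`, the second for `true`. -/
def sel : Bool → Formula L → Formula L → Formula L
  | false, A, _ => A
  | true, _, B => B

/-- The projections, indexed by the booleans. -/
def proj : ∀ (b : Bool) (A B : Formula L), prod A B ⟶ sel b A B
  | false, A, B => (k1 A B).arrow
  | true, A, B => (k2 A B).arrow

/-- The injections, indexed by the booleans. -/
def inj : ∀ (b : Bool) (A B : Formula L), sel b A B ⟶ sum A B
  | false, A, B => (l1 A B).arrow
  | true, A, B => (l2 A B).arrow

theorem arrow_eq {f g : Term A B} (h : TermEq f g) : f.arrow = g.arrow :=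
  Quotient.sound h

theorem arrow_comp (g : Term B C) (f : Term A B) : (comp g f).arrow = f.arrow ≫ g.arrow := rfl

theorem arrow_one : (one A).arrow = 𝟙 A := rfl

theorem exists_arrow_eq (f : A ⟶ B) : ∃ t : Term A B, t.arrow = f := Quotient.exists_rep f

theorem pair_arrow (f : Term C A) (g : Term C B) :
    pair f.arrow g.arrow = (comp (times f g) (w C)).arrow := rfl

theorem copair_arrow (f : Term A C) (g : Term B C) :
    copair f.arrow g.arrow = (comp (m C) (plus f g)).arrow := rfl

theorem pair_fst (f : C ⟶ A) (g : C ⟶ B) : pair f g ≫ (k1 A B).arrow = f := by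
  obtain ⟨f, rfl⟩ := exists_arrow_eq f
  obtain ⟨g, rfl⟩ := exists_arrow_eq g
  rw [pair_arrow, arrow_comp, Category.assoc, ← arrow_comp _ (times f g), arrow_eq (.k1_nat f g),
    arrow_comp, ← Category.assoc, ← arrow_comp, arrow_eq (.k1_w C), arrow_one, Category.id_comp]

theorem pair_snd (f : C ⟶ A) (g : C ⟶ B) : pair f g ≫ (k2 A B).arrow = g := by
  obtain ⟨f, rfl⟩ := exists_arrow_eq f
  obtain ⟨g, rfl⟩ := exists_arrow_eq g
  rw [pair_arrow, arrow_comp, Category.assoc, ← arrow_comp _ (times f g), arrow_eq (.k2_nat f g),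
    arrow_comp, ← Category.assoc, ← arrow_comp, arrow_eq (.k2_w C), arrow_one, Category.id_comp]

theorem inl_copair (f : A ⟶ C) (g : B ⟶ C) : (l1 A B).arrow ≫ copair f g = f := by
  obtain ⟨f, rfl⟩ := exists_arrow_eq f
  obtain ⟨g, rfl⟩ := exists_arrow_eq g
  rw [copair_arrow, arrow_comp, ← Category.assoc, ← arrow_comp (plus f g),
    arrow_eq (.l1_nat f g), arrow_comp, Category.assoc, ← arrow_comp, arrow_eq (.m_l1 C),
    arrow_one, Category.comp_id]

theorem inr_copair (f : A ⟶ C) (g : B ⟶ C) : (l2 A B).arrow ≫ copair f g = g := by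
  obtain ⟨f, rfl⟩ := exists_arrow_eq f
  obtain ⟨g, rfl⟩ := exists_arrow_eq g
  rw [copair_arrow, arrow_comp, ← Category.assoc, ← arrow_comp (plus f g),
    arrow_eq (.l2_nat f g), arrow_comp, Category.assoc, ← arrow_comp, arrow_eq (.m_l2 C),
    arrow_one, Category.comp_id]

theorem pair_eta (f : C ⟶ prod A B) :
    pair (f ≫ (k1 A B).arrow) (f ≫ (k2 A B).arrow) = f := by
  obtain ⟨f, rfl⟩ := exists_arrow_eq f
  rw [← arrow_comp, ← arrow_comp, pair_arrow, arrow_comp, arrow_eq (.times_comp _ _ _ _),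
    arrow_comp, ← Category.assoc, ← arrow_comp, ← arrow_eq (.w_nat f), arrow_comp,
    Category.assoc, ← arrow_comp, arrow_eq (.times_k1_k2_w A B), arrow_one, Category.comp_id]

theorem copair_eta (f : sum A B ⟶ C) :
    copair ((l1 A B).arrow ≫ f) ((l2 A B).arrow ≫ f) = f := by
  obtain ⟨f, rfl⟩ := exists_arrow_eq f
  rw [← arrow_comp, ← arrow_comp, copair_arrow, arrow_comp, arrow_eq (.plus_comp _ _ _ _),
    arrow_comp, Category.assoc, ← arrow_comp, ← arrow_eq (.m_nat f), arrow_comp,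
    ← Category.assoc, ← arrow_comp, arrow_eq (.m_plus_l1_l2 A B), arrow_one, Category.id_comp]

theorem prod_hom_ext {f g : C ⟶ prod A B} (h : ∀ b, f ≫ proj b A B = g ≫ proj b A B) :
    f = g := by
  rw [← pair_eta f, ← pair_eta g]
  exact congrArg₂ pair (h false) (h true)

theorem sum_hom_ext {f g : sum A B ⟶ C} (h : ∀ b, inj b A B ≫ f = inj b A B ≫ g) : f = g := by
  rw [← copair_eta f, ← copair_eta g]
  exact congrArg₂ copair (h false) (h true)

theorem comp_pair (h : D ⟶ C) (f : C ⟶ A) (g : C ⟶ B) :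
    h ≫ pair f g = pair (h ≫ f) (h ≫ g) := by
  rw [← pair_eta (h ≫ pair f g), Category.assoc, Category.assoc, pair_fst, pair_snd]

theorem copair_comp (f : A ⟶ C) (g : B ⟶ C) (h : C ⟶ D) :
    copair f g ≫ h = copair (f ≫ h) (g ≫ h) := by
  rw [← copair_eta (copair f g ≫ h), ← Category.assoc, ← Category.assoc, inl_copair, inr_copair]

theorem hom_I_unique (f g : A ⟶ I) : f = g := by
  obtain ⟨f, rfl⟩ := exists_arrow_eq f
  obtain ⟨g, rfl⟩ := exists_arrow_eq g
  exact arrow_eq (.trans (.k_unique f) (.symm (.k_unique g)))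

theorem O_hom_unique (f g : O ⟶ A) : f = g := by
  obtain ⟨f, rfl⟩ := exists_arrow_eq f
  obtain ⟨g, rfl⟩ := exists_arrow_eq g
  exact arrow_eq (.trans (.l_unique f) (.symm (.l_unique g)))

/-- Two arrows to `O` are the two projections of their pairing into `O × O`, and (kO) identifies
these projections. -/
theorem hom_O_unique (f g : A ⟶ O) : f = g := by
  rw [← pair_fst f g, arrow_eq .kO, pair_snd]

theorem I_hom_unique (f g : I ⟶ A) : f = g := by
  rw [← inl_copair f g, arrow_eq .lI, inr_copair]

end Structure

/-! ### Cut elimination. -/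

/-- Cut-free terms. -/
inductive CutFree : Formula L → Formula L → Type u
  | id (p : L) : CutFree (letter p) (letter p)
  | toI (A : Formula L) : CutFree A I
  | fromO (A : Formula L) : CutFree O A
  | pair {A B C : Formula L} (f : CutFree C A) (g : CutFree C B) : CutFree C (prod A B)
  | copair {A B C : Formula L} (f : CutFree A C) (g : CutFree B C) : CutFree (sum A B) C
  | proj (b : Bool) {A B C : Formula L} (f : CutFree (sel b A B) C) : CutFree (prod A B) C
  | inj (b : Bool) {A B C : Formula L} (f : CutFree C (sel b A B)) : CutFree C (sum A B)

namespace CutFree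

/-- The arrow for which a cut-free term stands. -/
def arrow : ∀ {A B : Formula L}, CutFree A B → (A ⟶ B)
  | _, _, id p => 𝟙 (letter p)
  | _, _, toI A => (k A).arrow
  | _, _, fromO A => (l A).arrow
  | _, _, pair f g => Dicartesian.pair f.arrow g.arrow
  | _, _, copair f g => Dicartesian.copair f.arrow g.arrow
  | _, _, proj b f => Dicartesian.proj b _ _ ≫ f.arrow
  | _, _, inj b f => f.arrow ≫ Dicartesian.inj b _ _

/-- Cut elimination: the composition is pushed into premises, past source-side rules of `f` and
target-side rules of `g`. What remains is a pairing against a projection or an injection against a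
copairing, where the beta laws select one component. -/
theorem exists_comp : ∀ {A B C : Formula L} (f : CutFree A B) (g : CutFree B C),
    ∃ h : CutFree A C, h.arrow = f.arrow ≫ g.arrow
  | _, _, _, id p, g => ⟨g, by simp [arrow]⟩
  | _, _, _, fromO A, g => ⟨fromO _, O_hom_unique _ _⟩
  | _, _, _, copair f₁ f₂, g => by
    obtain ⟨h₁, e₁⟩ := exists_comp f₁ g
    obtain ⟨h₂, e₂⟩ := exists_comp f₂ g
    exact ⟨copair h₁ h₂, by simp [arrow, e₁, e₂, copair_comp]⟩
  | _, _, _, proj b f, g => by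
    obtain ⟨h, e⟩ := exists_comp f g
    exact ⟨proj b h, by simp [arrow, e]⟩
  | _, _, I, f, toI _ => ⟨toI _, hom_I_unique _ _⟩
  | _, _, _, f, pair g₁ g₂ => by
    obtain ⟨h₁, e₁⟩ := exists_comp f g₁
    obtain ⟨h₂, e₂⟩ := exists_comp f g₂
    exact ⟨pair h₁ h₂, by simp [arrow, e₁, e₂, comp_pair]⟩
  | _, _, _, f, inj b g => by
    obtain ⟨h, e⟩ := exists_comp f g
    exact ⟨inj b h, by simp [arrow, e]⟩
  | _, _, _, pair f₁ f₂, proj false g => by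
    obtain ⟨h, e⟩ := exists_comp f₁ g
    exact ⟨h, e.trans ((congrArg (· ≫ g.arrow) (pair_fst f₁.arrow f₂.arrow)).symm.trans
      (Category.assoc _ _ _))⟩
  | _, _, _, pair f₁ f₂, proj true g => by
    obtain ⟨h, e⟩ := exists_comp f₂ g
    exact ⟨h, e.trans ((congrArg (· ≫ g.arrow) (pair_snd f₁.arrow f₂.arrow)).symm.trans
      (Category.assoc _ _ _))⟩
  | _, _, _, inj false f, copair g₁ g₂ => by
    obtain ⟨h, e⟩ := exists_comp f g₁
    exact ⟨h, e.trans ((congrArg (f.arrow ≫ ·) (inl_copair g₁.arrow g₂.arrow)).symm.trans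
      (Category.assoc _ _ _).symm)⟩
  | _, _, _, inj true f, copair g₁ g₂ => by
    obtain ⟨h, e⟩ := exists_comp f g₂
    exact ⟨h, e.trans ((congrArg (f.arrow ≫ ·) (inr_copair g₁.arrow g₂.arrow)).symm.trans
      (Category.assoc _ _ _).symm)⟩
termination_by _ _ _ f g => sizeOf f + sizeOf g
decreasing_by
  all_goals first
    | decreasing_tactic
    | simp_wf
      refine Nat.add_lt_add ?_ ?_ <;>
        first | omega | exact Nat.lt_add_of_pos_left (by omega) |
          exact Nat.lt_add_right _ (Nat.lt_add_of_pos_left (by omega))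

/-- Only letters have a primitive identity; the other identities are eta-expanded. -/
theorem exists_id : ∀ A : Formula L, ∃ h : CutFree A A, h.arrow = 𝟙 A
  | letter p => ⟨id p, rfl⟩
  | I => ⟨toI _, hom_I_unique _ _⟩
  | O => ⟨fromO _, O_hom_unique _ _⟩
  | Formula.prod A B => by
    obtain ⟨h₁, e₁⟩ := exists_id A
    obtain ⟨h₂, e₂⟩ := exists_id B
    refine ⟨pair (proj false (B := B) h₁) (proj true (A := A) h₂), ?_⟩
    rw [← pair_eta (𝟙 (Formula.prod A B)), Category.id_comp, Category.id_comp]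
    exact congrArg₂ Dicartesian.pair
      ((congrArg ((k1 A B).arrow ≫ ·) e₁).trans (Category.comp_id _))
      ((congrArg ((k2 A B).arrow ≫ ·) e₂).trans (Category.comp_id _))
  | Formula.sum A B => by
    obtain ⟨h₁, e₁⟩ := exists_id A
    obtain ⟨h₂, e₂⟩ := exists_id B
    refine ⟨copair (inj false (B := B) h₁) (inj true (A := A) h₂), ?_⟩
    rw [← copair_eta (𝟙 (Formula.sum A B)), Category.comp_id, Category.comp_id]
    exact congrArg₂ Dicartesian.copair
      ((congrArg (· ≫ (l1 A B).arrow) e₁).trans (Category.id_comp _))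
      ((congrArg (· ≫ (l2 A B).arrow) e₂).trans (Category.id_comp _))

theorem exists_proj (b : Bool) (A B : Formula L) :
    ∃ h : CutFree (Formula.prod A B) (sel b A B), h.arrow = Dicartesian.proj b A B := by
  obtain ⟨h, e⟩ := exists_id (sel b A B)
  exact ⟨proj b h, by simp [arrow, e]⟩

theorem exists_inj (b : Bool) (A B : Formula L) :
    ∃ h : CutFree (sel b A B) (Formula.sum A B), h.arrow = Dicartesian.inj b A B := by
  obtain ⟨h, e⟩ := exists_id (sel b A B)
  exact ⟨inj b h, by simp [arrow, e]⟩

theorem exists_term {A B : Formula L} (t : Term A B) : ∃ h : CutFree A B, h.arrow = t.arrow := by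
  induction t with
  | one A => exact exists_id A
  | k A => exact ⟨toI A, rfl⟩
  | l A => exact ⟨fromO A, rfl⟩
  | k1 A B => exact exists_proj false A B
  | k2 A B => exact exists_proj true A B
  | l1 A B => exact exists_inj false A B
  | l2 A B => exact exists_inj true A B
  | w A =>
    obtain ⟨h, e⟩ := exists_id A
    refine ⟨pair h h, ?_⟩
    rw [arrow, e, ← arrow_one, pair_arrow, arrow_comp, arrow_eq (.times_one A A), arrow_one,
      Category.comp_id]
  | m A =>
    obtain ⟨h, e⟩ := exists_id A
    refine ⟨copair h h, ?_⟩
    rw [arrow, e, ← arrow_one, copair_arrow, arrow_comp, arrow_eq (.plus_one A A), arrow_one,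
      Category.id_comp]
  | comp g f ihg ihf =>
    obtain ⟨h₁, e₁⟩ := ihf
    obtain ⟨h₂, e₂⟩ := ihg
    rw [arrow_comp, ← e₁, ← e₂]
    exact exists_comp h₁ h₂
  | @times A B C D f g ihf ihg =>
    obtain ⟨h₁, e₁⟩ := ihf
    obtain ⟨h₂, e₂⟩ := ihg
    refine ⟨pair (proj false (B := C) h₁) (proj true (A := A) h₂), ?_⟩
    rw [← pair_eta (times f g).arrow, ← arrow_comp, ← arrow_comp, arrow_eq (.k1_nat f g),
      arrow_eq (.k2_nat f g), arrow_comp, arrow_comp, ← e₁, ← e₂]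
    rfl
  | @plus A B C D f g ihf ihg =>
    obtain ⟨h₁, e₁⟩ := ihf
    obtain ⟨h₂, e₂⟩ := ihg
    refine ⟨copair (inj false (B := D) h₁) (inj true (A := B) h₂), ?_⟩
    rw [← copair_eta (plus f g).arrow, ← arrow_comp, ← arrow_comp, arrow_eq (.l1_nat f g),
      arrow_eq (.l2_nat f g), arrow_comp, arrow_comp, ← e₁, ← e₂]
    rfl

theorem exists_hom {A B : Formula L} (f : A ⟶ B) : ∃ h : CutFree A B, h.arrow = f := by
  obtain ⟨t, rfl⟩ := exists_arrow_eq f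
  exact exists_term t

end CutFree

/-! ### Links between letter occurrences. -/

section Graph

variable {A B C : Formula L}

/-- The relation between letter occurrences assigned to an arrow by `G`. -/
def Linked (f : A ⟶ B) (x y : ℕ) : Prop :=
  (x, y) ∈ (show GraphHom ⟨A.size⟩ ⟨B.size⟩ from G.map f).rel

/-- The position at which the selected immediate subformula starts, `A` being the left one. -/
def offset : Bool → Formula L → ℕ
  | false, _ => 0
  | true, A => A.size

theorem Linked.bound {f : A ⟶ B} {x y : ℕ} (h : Linked f x y) : x < A.size ∧ y < B.size :=
  (show GraphHom ⟨A.size⟩ ⟨B.size⟩ from G.map f).bound _ h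

theorem linked_arrow {f : Term A B} {x y : ℕ} : Linked f.arrow x y ↔ (x, y) ∈ f.graph := Iff.rfl

theorem linked_comp {f : A ⟶ B} {g : B ⟶ C} {x z : ℕ} :
    Linked (f ≫ g) x z ↔ ∃ y, Linked f x y ∧ Linked g y z := by
  obtain ⟨f, rfl⟩ := exists_arrow_eq f
  obtain ⟨g, rfl⟩ := exists_arrow_eq g
  exact Iff.rfl

theorem linked_proj {b : Bool} {x y : ℕ} :
    Linked (proj b A B) x y ↔ x = offset b A + y ∧ y < (sel b A B).size := by
  cases b
  · simp only [proj, linked_arrow, mem_graph_k1, offset, sel]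
    omega
  · simp only [proj, linked_arrow, mem_graph_k2, offset, sel]
    omega

theorem linked_inj {b : Bool} {x y : ℕ} :
    Linked (inj b A B) x y ↔ y = offset b A + x ∧ x < (sel b A B).size := by
  cases b
  · simp only [inj, linked_arrow, mem_graph_l1, offset, sel]
    omega
  · simp only [inj, linked_arrow, mem_graph_l2, offset, sel]
    omega

theorem linked_proj_comp {b : Bool} {f : sel b A B ⟶ C} {x y : ℕ} :
    Linked (proj b A B ≫ f) x y ↔ ∃ x', x = offset b A + x' ∧ Linked f x' y := by
  simp only [linked_comp, linked_proj]
  exact ⟨fun ⟨z, h, h'⟩ => ⟨z, h.1, h'⟩, fun ⟨z, h, h'⟩ => ⟨z, ⟨h, h'.bound.1⟩, h'⟩⟩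

theorem linked_comp_inj {b : Bool} {f : C ⟶ sel b A B} {x y : ℕ} :
    Linked (f ≫ inj b A B) x y ↔ ∃ y', y = offset b A + y' ∧ Linked f x y' := by
  simp only [linked_comp, linked_inj]
  exact ⟨fun ⟨z, h, h'⟩ => ⟨z, h'.1, h⟩, fun ⟨z, h, h'⟩ => ⟨z, h', h, h'.bound.2⟩⟩

/-- Precomposing with a projection only shifts source positions by `offset`, so the relation of the
remaining arrow can be read off. -/
theorem linked_congr_of_proj {b : Bool} {f g : sel b A B ⟶ C}
    (h : ∀ x y, Linked (proj b A B ≫ f) x y ↔ Linked (proj b A B ≫ g) x y) (x y : ℕ) :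
    Linked f x y ↔ Linked g x y := by
  have := h (offset b A + x) y
  simpa [linked_proj_comp] using this

theorem linked_congr_of_inj {b : Bool} {f g : C ⟶ sel b A B}
    (h : ∀ x y, Linked (f ≫ inj b A B) x y ↔ Linked (g ≫ inj b A B) x y) (x y : ℕ) :
    Linked f x y ↔ Linked g x y := by
  have := h x (offset b A + y)
  simpa [linked_comp_inj] using this

/-- A component is the pairing followed by a projection, so each of its links passes through a link
of the pairing with the same source position. This hands conditions on source positions, and absence
of links, down to components. -/
theorem Linked.pair_left {f : C ⟶ A} {x y : ℕ} (h : Linked f x y) (g : C ⟶ B) :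
    ∃ y', Linked (pair f g) x y' := by
  rw [← pair_fst f g, linked_comp] at h
  exact h.imp fun _ h => h.1

theorem Linked.pair_right {g : C ⟶ B} {x y : ℕ} (h : Linked g x y) (f : C ⟶ A) :
    ∃ y', Linked (pair f g) x y' := by
  rw [← pair_snd f g, linked_comp] at h
  exact h.imp fun _ h => h.1

theorem Linked.copair_left {f : A ⟶ C} {x y : ℕ} (h : Linked f x y) (g : B ⟶ C) :
    ∃ x', Linked (copair f g) x' y := by
  rw [← inl_copair f g, linked_comp] at h
  exact h.imp fun _ h => h.2

theorem Linked.copair_right {g : B ⟶ C} {x y : ℕ} (h : Linked g x y) (f : A ⟶ C) :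
    ∃ x', Linked (copair f g) x' y := by
  rw [← inr_copair f g, linked_comp] at h
  exact h.imp fun _ h => h.2

end Graph

/-! ### Null arrows, and factorization through a projection or an injection. -/

section Factorization

variable {A B C : Formula L}

/-- The arrow factors through `O` or through `I`. -/
def IsNull (f : A ⟶ B) : Prop :=
  (∃ c : A ⟶ O, f = c ≫ (l B).arrow) ∨ ∃ t : I ⟶ B, f = (k A).arrow ≫ t

/-- Once `c` exists, the two kinds of null arrow merge: `A ⟶ I` itself factors through `c`, and
arrows out of `O` are unique. -/
theorem IsNull.eq_of_hom_O {f : A ⟶ B} (h : IsNull f) (c : A ⟶ O) : f = c ≫ (l B).arrow := by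
  obtain ⟨c', rfl⟩ | ⟨t, rfl⟩ := h
  · rw [hom_O_unique c' c]
  · rw [hom_I_unique (k A).arrow (c ≫ (k O).arrow), Category.assoc]
    exact congrArg _ (O_hom_unique _ _)

theorem IsNull.eq_of_I_hom {f : A ⟶ B} (h : IsNull f) (t : I ⟶ B) : f = (k A).arrow ≫ t := by
  obtain ⟨c, rfl⟩ | ⟨t', rfl⟩ := h
  · exact (IsNull.eq_of_hom_O (Or.inr ⟨t, rfl⟩) c).symm
  · rw [I_hom_unique t' t]

theorem IsNull.unique {f g : A ⟶ B} (hf : IsNull f) (hg : IsNull g) : f = g := by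
  obtain ⟨c, e⟩ | ⟨t, e⟩ := id hg
  · rw [e, hf.eq_of_hom_O c]
  · rw [e, hf.eq_of_I_hom t]

theorem IsNull.comp_left {g : B ⟶ C} (hg : IsNull g) (f : A ⟶ B) : IsNull (f ≫ g) := by
  obtain ⟨c, rfl⟩ | ⟨t, rfl⟩ := hg
  · exact Or.inl ⟨f ≫ c, (Category.assoc _ _ _).symm⟩
  · exact Or.inr ⟨t, by rw [← Category.assoc]; exact congrArg (· ≫ t) (hom_I_unique _ _)⟩

theorem IsNull.comp_right {f : A ⟶ B} (hf : IsNull f) (g : B ⟶ C) : IsNull (f ≫ g) := by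
  obtain ⟨c, rfl⟩ | ⟨t, rfl⟩ := hf
  · exact Or.inl ⟨c, by rw [Category.assoc]; exact congrArg (c ≫ ·) (O_hom_unique _ _)⟩
  · exact Or.inr ⟨t ≫ g, Category.assoc _ _ _⟩

/-- The danger is one component through `O` and the other through `I`. If `C ⟶ O` exists, both can
be taken through `O`; if not, both must go through `I`. -/
theorem IsNull.pair {f : C ⟶ A} {g : C ⟶ B} (hf : IsNull f) (hg : IsNull g) :
    IsNull (pair f g) := by
  by_cases hC : Nonempty (C ⟶ O)
  · obtain ⟨c⟩ := hC
    refine Or.inl ⟨c, ?_⟩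
    rw [hf.eq_of_hom_O c, hg.eq_of_hom_O c, ← comp_pair]
    exact congrArg _ (O_hom_unique _ _)
  · obtain ⟨c, -⟩ | ⟨t, rfl⟩ := hf
    · exact absurd ⟨c⟩ hC
    obtain ⟨c, -⟩ | ⟨t', rfl⟩ := hg
    · exact absurd ⟨c⟩ hC
    exact Or.inr ⟨_, (comp_pair _ t t').symm⟩

theorem IsNull.copair {f : A ⟶ C} {g : B ⟶ C} (hf : IsNull f) (hg : IsNull g) :
    IsNull (copair f g) := by
  by_cases hC : Nonempty (I ⟶ C)
  · obtain ⟨t⟩ := hC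
    refine Or.inr ⟨t, ?_⟩
    rw [hf.eq_of_I_hom t, hg.eq_of_I_hom t, ← copair_comp]
    exact congrArg (· ≫ t) (hom_I_unique _ _)
  · obtain ⟨c, rfl⟩ | ⟨t, -⟩ := hf
    · obtain ⟨c', rfl⟩ | ⟨t, -⟩ := hg
      · exact Or.inl ⟨_, (copair_comp c c' _).symm⟩
      · exact absurd ⟨t⟩ hC
    · exact absurd ⟨t⟩ hC

theorem CutFree.isNull {A B : Formula L} (f : CutFree A B) (h : ∀ x y, ¬ Linked f.arrow x y) :
    IsNull f.arrow := by
  induction f with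
  | id p =>
    -- The identity of a letter links position 0 to itself, so this rule cannot occur.
    refine absurd ?_ (h 0 0)
    rw [arrow, ← arrow_one, linked_arrow, mem_graph_one]
    exact ⟨rfl, Nat.one_pos⟩
  | toI A => exact Or.inr ⟨𝟙 I, (Category.comp_id _).symm⟩
  | fromO A => exact Or.inl ⟨𝟙 O, (Category.id_comp _).symm⟩
  | pair f g ihf ihg =>
    exact (ihf fun x y hl => (hl.pair_left g.arrow).elim fun _ => h _ _).pair
      (ihg fun x y hl => (hl.pair_right f.arrow).elim fun _ => h _ _)
  | copair f g ihf ihg =>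
    exact (ihf fun x y hl => (hl.copair_left g.arrow).elim fun _ => h _ _).copair
      (ihg fun x y hl => (hl.copair_right f.arrow).elim fun _ => h _ _)
  | proj b f ih =>
    exact (ih fun x y hl => h _ _ (linked_proj_comp.2 ⟨x, rfl, hl⟩)).comp_left _
  | inj b f ih =>
    exact (ih fun x y hl => h _ _ (linked_comp_inj.2 ⟨y, rfl, hl⟩)).comp_right _

theorem isNull_of_not_linked {f : A ⟶ B} (h : ∀ x y, ¬ Linked f x y) : IsNull f := by
  obtain ⟨f, rfl⟩ := CutFree.exists_hom f
  exact f.isNull h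

/-- The position `x` of a compound formula, whose left part is `A`, is in the selected part. -/
def InPart (b : Bool) (A B : Formula L) (x : ℕ) : Prop :=
  ∃ x' < (sel b A B).size, x = offset b A + x'

theorem InPart.eq {b b' : Bool} {x : ℕ} (h : InPart b A B x) (h' : InPart b' A B x) :
    b = b' := by
  obtain ⟨y, hy, e⟩ := h
  obtain ⟨y', hy', e'⟩ := h'
  cases b <;> cases b' <;> simp only [offset, sel] at * <;> omega

theorem Linked.inPart_proj {b : Bool} {f : sel b A B ⟶ C} {x y : ℕ}
    (h : Linked (proj b A B ≫ f) x y) : InPart b A B x := by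
  obtain ⟨x', e, h⟩ := linked_proj_comp.1 h
  exact ⟨x', h.bound.1, e⟩

theorem Linked.inPart_inj {b : Bool} {f : C ⟶ sel b A B} {x y : ℕ}
    (h : Linked (f ≫ inj b A B) x y) : InPart b A B y := by
  obtain ⟨y', e, h⟩ := linked_comp_inj.1 h
  exact ⟨y', h.bound.2, e⟩

/-- If no link touches the other factor, that factor can matter only through a linkless subterm that
projects to it and then passes through `O`. This is excluded if the factor is not a contradiction,
or if there are no pairings to create linkless branches beside a linked one. The equation `hP` keeps
the source index a variable for the induction. -/
theorem CutFree.exists_proj_comp_eq {P B : Formula L} (f : CutFree P B) {A₁ A₂ : Formula L}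
    (hP : P = prod A₁ A₂) (b : Bool) (hl : ∀ x y, Linked f.arrow x y → InPart b A₁ A₂ x)
    (h : ¬ IsContradiction (sel (!b) A₁ A₂) ∨ (¬ B.ProdOccurs ∧ ∃ x y, Linked f.arrow x y)) :
    ∃ g : sel b A₁ A₂ ⟶ B, f.arrow = hP ▸ (Dicartesian.proj b A₁ A₂ ≫ g) := by
  induction f with
  | id p => cases hP
  | toI A => exact ⟨(k _).arrow, hom_I_unique _ _⟩
  | fromO A => cases hP
  | pair f₁ f₂ ih₁ ih₂ =>
    subst hP
    obtain h | h := h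
    · obtain ⟨g₁, e₁⟩ := ih₁ rfl
        (fun x y hh => (hh.pair_left f₂.arrow).elim fun _ => hl _ _) (Or.inl h)
      obtain ⟨g₂, e₂⟩ := ih₂ rfl
        (fun x y hh => (hh.pair_right f₁.arrow).elim fun _ => hl _ _) (Or.inl h)
      exact ⟨Dicartesian.pair g₁ g₂, by simp only [arrow, e₁, e₂, comp_pair]⟩
    -- A component of the pairing might have no link, so the second alternative would not descend;
    -- but it forbids `×` in the target.
    · exact absurd trivial h.1
  | copair f g ihf ihg => cases hP
  | proj b' f ih =>
    cases hP
    by_cases hb : b' = b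
    · subst hb
      exact ⟨f.arrow, rfl⟩
    -- A projection to the wrong factor leaves no room for links, so its premise is null. Passing
    -- through `I`, it can be rerouted along the right projection.
    · have hf : ∀ x y, ¬ Linked (Dicartesian.proj b' A₁ A₂ ≫ f.arrow) x y :=
        fun x y hh => hb (hh.inPart_proj.eq (hl x y hh))
      have hb' : b' = !b := by cases b <;> cases b' <;> simp_all
      subst hb'
      obtain h | ⟨-, x, y, h⟩ := h
      · obtain ⟨c, -⟩ | ⟨t, e⟩ := f.isNull fun x y hh =>
          hf _ _ (linked_proj_comp.2 ⟨x, rfl, hh⟩)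
        · exact absurd ⟨c⟩ h
        · refine ⟨(k _).arrow ≫ t, ?_⟩
          simp only [arrow, e]
          rw [← Category.assoc, ← Category.assoc]
          exact congrArg (· ≫ t) (hom_I_unique _ _)
      · exact absurd h (hf x y)
  | @inj b' B₁ B₂ C f ih =>
    subst hP
    obtain ⟨g, e⟩ := ih rfl (fun x y hh => hl _ _ (linked_comp_inj.2 ⟨y, rfl, hh⟩)) (by
      refine h.imp_right fun ⟨h, x, y, hh⟩ => ⟨fun h' => h ?_, ?_⟩
      · cases b'
        · exact Or.inl h'
        · exact Or.inr h'
      · obtain ⟨y', -, hh⟩ := linked_comp_inj.1 hh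
        exact ⟨x, y', hh⟩)
    exact ⟨g ≫ Dicartesian.inj b' _ _, by simp only [arrow, e, Category.assoc]⟩

/-- Dual of `CutFree.exists_proj_comp_eq`: tautologies replace contradictions, and copairings are
the obstacle. -/
theorem CutFree.exists_comp_inj_eq {A S : Formula L} (f : CutFree A S) {B₁ B₂ : Formula L}
    (hS : S = sum B₁ B₂) (b : Bool) (hl : ∀ x y, Linked f.arrow x y → InPart b B₁ B₂ y)
    (h : ¬ IsTautology (sel (!b) B₁ B₂) ∨ (¬ A.SumOccurs ∧ ∃ x y, Linked f.arrow x y)) :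
    ∃ g : A ⟶ sel b B₁ B₂, f.arrow = hS ▸ (g ≫ Dicartesian.inj b B₁ B₂) := by
  induction f with
  | id p => cases hS
  | toI A => cases hS
  | fromO A => exact ⟨(l _).arrow, O_hom_unique _ _⟩
  | copair f₁ f₂ ih₁ ih₂ =>
    subst hS
    obtain h | h := h
    · obtain ⟨g₁, e₁⟩ := ih₁ rfl
        (fun x y hh => (hh.copair_left f₂.arrow).elim fun _ => hl _ _) (Or.inl h)
      obtain ⟨g₂, e₂⟩ := ih₂ rfl
        (fun x y hh => (hh.copair_right f₁.arrow).elim fun _ => hl _ _) (Or.inl h)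
      exact ⟨Dicartesian.copair g₁ g₂, by simp only [arrow, e₁, e₂, copair_comp]⟩
    · exact absurd trivial h.1
  | pair f g ihf ihg => cases hS
  | inj b' f ih =>
    cases hS
    by_cases hb : b' = b
    · subst hb
      exact ⟨f.arrow, rfl⟩
    · have hf : ∀ x y, ¬ Linked (f.arrow ≫ Dicartesian.inj b' B₁ B₂) x y :=
        fun x y hh => hb (hh.inPart_inj.eq (hl x y hh))
      have hb' : b' = !b := by cases b <;> cases b' <;> simp_all
      subst hb'
      obtain h | ⟨-, x, y, h⟩ := h
      · obtain ⟨c, e⟩ | ⟨t, -⟩ := f.isNull fun x y hh =>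
          hf _ _ (linked_comp_inj.2 ⟨y, rfl, hh⟩)
        · refine ⟨c ≫ (l _).arrow, ?_⟩
          simp only [arrow, e]
          rw [Category.assoc, Category.assoc]
          exact congrArg (c ≫ ·) (O_hom_unique _ _)
        · exact absurd ⟨t⟩ h
      · exact absurd h (hf x y)
  | @proj b' A₁ A₂ C f ih =>
    subst hS
    obtain ⟨g, e⟩ := ih rfl (fun x y hh => hl _ _ (linked_proj_comp.2 ⟨x, rfl, hh⟩)) (by
      refine h.imp_right fun ⟨h, x, y, hh⟩ => ⟨fun h' => h ?_, ?_⟩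
      · cases b'
        · exact Or.inl h'
        · exact Or.inr h'
      · obtain ⟨x', -, hh⟩ := linked_proj_comp.1 hh
        exact ⟨x', y, hh⟩)
    exact ⟨Dicartesian.proj b' _ _ ≫ g, by simp only [arrow, e, Category.assoc]⟩

end Factorization

/-! ### Inheritance of normality and the main induction. -/

section Coherence

variable {A B C A₁ A₂ B₁ B₂ : Formula L}

theorem ONormal.of_prod (h : ONormal (prod A B)) (b : Bool) : ONormal (sel b A B) := by
  cases b
  · exact fun C D hs => h C D (hs.imp .prod_left .prod_left)
  · exact fun C D hs => h C D (hs.imp .prod_right .prod_right)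

theorem ONormal.of_sum (h : ONormal (sum A B)) (b : Bool) : ONormal (sel b A B) := by
  cases b
  · exact fun C D hs => h C D (hs.imp .sum_left .sum_left)
  · exact fun C D hs => h C D (hs.imp .sum_right .sum_right)

theorem INormal.of_prod (h : INormal (prod A B)) (b : Bool) : INormal (sel b A B) := by
  cases b
  · exact fun C D hs => h C D (hs.imp .prod_left .prod_left)
  · exact fun C D hs => h C D (hs.imp .prod_right .prod_right)

theorem INormal.of_sum (h : INormal (sum A B)) (b : Bool) : INormal (sel b A B) := by
  cases b
  · exact fun C D hs => h C D (hs.imp .sum_left .sum_left)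
  · exact fun C D hs => h C D (hs.imp .sum_right .sum_right)

theorem ONormal.not_sumOccurs (h : ONormal (prod A B)) {b : Bool}
    (hc : IsContradiction (sel (!b) A B)) : ¬ (sel b A B).SumOccurs := by
  cases b
  · exact h B A (Or.inl (.refl _)) hc
  · exact h A B (Or.inr (.refl _)) hc

theorem INormal.not_prodOccurs (h : INormal (sum A B)) {b : Bool}
    (ht : IsTautology (sel (!b) A B)) : ¬ (sel b A B).ProdOccurs := by
  cases b
  · exact h B A (Or.inl (.refl _)) ht
  · exact h A B (Or.inr (.refl _)) ht

/-- Arrows `A ⟶ B` are determined by their relations. -/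
def Coherent (A B : Formula L) : Prop :=
  ∀ f g : A ⟶ B, (∀ x y, Linked f x y ↔ Linked g x y) → f = g

theorem coherent_of_inj (h : ∀ b, Coherent (sel b A₁ A₂) B) : Coherent (sum A₁ A₂) B :=
  fun f g hfg => sum_hom_ext fun b => h b _ _ fun x y => by simp only [linked_comp, hfg]

theorem coherent_of_proj (h : ∀ b, Coherent A (sel b B₁ B₂)) : Coherent A (prod B₁ B₂) :=
  fun f g hfg => prod_hom_ext fun b => h b _ _ fun x y => by simp only [linked_comp, hfg]

theorem proj_comp_eq_proj_comp {b c : Bool} (h : Coherent (sel b A₁ A₂) B)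
    {f : sel b A₁ A₂ ⟶ B} {g : sel c A₁ A₂ ⟶ B}
    (hfg : ∀ x y, Linked (proj b A₁ A₂ ≫ f) x y ↔ Linked (proj c A₁ A₂ ≫ g) x y)
    (hl : ∃ x y, Linked (proj b A₁ A₂ ≫ f) x y) :
    proj b A₁ A₂ ≫ f = proj c A₁ A₂ ≫ g := by
  obtain ⟨x, y, hl⟩ := hl
  obtain rfl := hl.inPart_proj.eq ((hfg x y).1 hl).inPart_proj
  rw [h f g (linked_congr_of_proj hfg)]

theorem comp_inj_eq_comp_inj {b c : Bool} (h : Coherent A (sel b B₁ B₂))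
    {f : A ⟶ sel b B₁ B₂} {g : A ⟶ sel c B₁ B₂}
    (hfg : ∀ x y, Linked (f ≫ inj b B₁ B₂) x y ↔ Linked (g ≫ inj c B₁ B₂) x y)
    (hl : ∃ x y, Linked (f ≫ inj b B₁ B₂) x y) :
    f ≫ inj b B₁ B₂ = g ≫ inj c B₁ B₂ := by
  obtain ⟨x, y, hl⟩ := hl
  obtain rfl := hl.inPart_inj.eq ((hfg x y).1 hl).inPart_inj
  rw [h f g (linked_congr_of_inj hfg)]

/-- The crossed case, the only one in which normality is used for more than passing to subformulae.
-/
theorem proj_comp_eq_comp_inj {b c : Bool}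
    (hN : ONormal (prod A₁ A₂) ∨ INormal (sum B₁ B₂))
    (hA : Coherent (sel b A₁ A₂) (sum B₁ B₂)) (hB : Coherent (prod A₁ A₂) (sel c B₁ B₂))
    {f : sel b A₁ A₂ ⟶ sum B₁ B₂} {g : prod A₁ A₂ ⟶ sel c B₁ B₂}
    (hfg : ∀ x y, Linked (proj b A₁ A₂ ≫ f) x y ↔ Linked (g ≫ inj c B₁ B₂) x y)
    (hl : ∃ x y, Linked (proj b A₁ A₂ ≫ f) x y) :
    proj b A₁ A₂ ≫ f = g ≫ inj c B₁ B₂ := by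
  have hf : ∀ x y, Linked f x y → InPart c B₁ B₂ y := fun x y h =>
    ((hfg _ _).1 (linked_proj_comp.2 ⟨x, rfl, h⟩)).inPart_inj
  have hg : ∀ x y, Linked g x y → InPart b A₁ A₂ x := fun x y h =>
    ((hfg _ _).2 (linked_comp_inj.2 ⟨y, rfl, h⟩)).inPart_proj
  have hlf : ∃ x y, Linked f x y := by
    obtain ⟨x, y, h⟩ := hl
    obtain ⟨x', -, h⟩ := linked_proj_comp.1 h
    exact ⟨x', y, h⟩
  have hlg : ∃ x y, Linked g x y := by
    obtain ⟨x, y, h⟩ := hl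
    obtain ⟨y', -, h⟩ := linked_comp_inj.1 ((hfg x y).1 h)
    exact ⟨x, y', h⟩
  -- Either factorization suffices: the common projection or injection is then stripped and the
  -- smaller coherence hypothesis compares the rest.
  have key : (∃ h : sel b A₁ A₂ ⟶ sel c B₁ B₂, g = proj b A₁ A₂ ≫ h) ∨
      ∃ h : sel b A₁ A₂ ⟶ sel c B₁ B₂, f = h ≫ inj c B₁ B₂ := by
    obtain ⟨f, rfl⟩ := CutFree.exists_hom f
    obtain ⟨g, rfl⟩ := CutFree.exists_hom g
    obtain hN | hN := hN
    · by_cases hc : IsContradiction (sel (!b) A₁ A₂)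
      · exact Or.inr (f.exists_comp_inj_eq rfl c hf (Or.inr ⟨hN.not_sumOccurs hc, hlf⟩))
      · exact Or.inl (g.exists_proj_comp_eq rfl b hg (Or.inl hc))
    · by_cases ht : IsTautology (sel (!c) B₁ B₂)
      · exact Or.inl (g.exists_proj_comp_eq rfl b hg (Or.inr ⟨hN.not_prodOccurs ht, hlg⟩))
      · exact Or.inr (f.exists_comp_inj_eq rfl c hf (Or.inl ht))
  obtain ⟨h, rfl⟩ | ⟨h, rfl⟩ := key
  · simp only [Category.assoc] at hfg ⊢
    rw [hA _ _ (linked_congr_of_proj hfg)]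
  · simp only [← Category.assoc] at hfg ⊢
    rw [hB _ _ (linked_congr_of_inj hfg)]

theorem sizeOf_sel_lt_prod (b : Bool) (A B : Formula L) :
    sizeOf (sel b A B) < sizeOf (prod A B) := by
  cases b <;> simp only [sel, prod.sizeOf_spec] <;> omega

theorem sizeOf_sel_lt_sum (b : Bool) (A B : Formula L) :
    sizeOf (sel b A B) < sizeOf (sum A B) := by
  cases b <;> simp only [sel, sum.sizeOf_spec] <;> omega

theorem coherent (A B : Formula L) (hN : ONormal A ∨ INormal B) : Coherent A B := by
  induction hn : sizeOf A + sizeOf B using Nat.strong_induction_on generalizing A B with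
  | _ n ih =>
  subst hn
  -- Four forms of the induction hypothesis: source or target is replaced by an immediate
  -- subformula, which inherits normality.
  have projA : ∀ {A₁ A₂}, A = prod A₁ A₂ → ∀ b, Coherent (sel b A₁ A₂) B := by
    rintro A₁ A₂ rfl b
    exact ih _ (Nat.add_lt_add_right (sizeOf_sel_lt_prod b A₁ A₂) _) _ _
      (hN.imp_left (·.of_prod b)) rfl
  have injA : ∀ {A₁ A₂}, A = sum A₁ A₂ → ∀ b, Coherent (sel b A₁ A₂) B := by
    rintro A₁ A₂ rfl b
    exact ih _ (Nat.add_lt_add_right (sizeOf_sel_lt_sum b A₁ A₂) _) _ _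
      (hN.imp_left (·.of_sum b)) rfl
  have projB : ∀ {B₁ B₂}, B = prod B₁ B₂ → ∀ b, Coherent A (sel b B₁ B₂) := by
    rintro B₁ B₂ rfl b
    exact ih _ (Nat.add_lt_add_left (sizeOf_sel_lt_prod b B₁ B₂) _) _ _
      (hN.imp_right (·.of_prod b)) rfl
  have injB : ∀ {B₁ B₂}, B = sum B₁ B₂ → ∀ b, Coherent A (sel b B₁ B₂) := by
    rintro B₁ B₂ rfl b
    exact ih _ (Nat.add_lt_add_left (sizeOf_sel_lt_sum b B₁ B₂) _) _ _
      (hN.imp_right (·.of_sum b)) rfl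
  intro f g hfg
  by_cases hl : ∃ x y, Linked f x y
  swap
  -- Without links both arrows are null, hence equal; every later case has a link available.
  · push Not at hl
    exact (isNull_of_not_linked hl).unique
      (isNull_of_not_linked fun x y h => hl x y ((hfg x y).2 h))
  have hl' : ∃ x y, Linked g x y := by simpa only [hfg] using hl
  obtain ⟨f, rfl⟩ := CutFree.exists_hom f
  obtain ⟨g, rfl⟩ := CutFree.exists_hom g
  cases f with
  | toI => exact hom_I_unique _ _
  | fromO => exact O_hom_unique _ _
  | pair f₁ f₂ => exact coherent_of_proj (projB rfl) _ _ hfg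
  | copair f₁ f₂ => exact coherent_of_inj (injA rfl) _ _ hfg
  | id p =>
    cases g
    rfl
  | proj b f =>
    cases g with
    | toI => exact hom_I_unique _ _
    | pair g₁ g₂ => exact coherent_of_proj (projB rfl) _ _ hfg
    | proj c g => exact proj_comp_eq_proj_comp (projA rfl b) hfg hl
    | inj c g => exact proj_comp_eq_comp_inj hN (projA rfl b) (injB rfl c) hfg hl
  | inj b f =>
    cases g with
    | fromO => exact O_hom_unique _ _
    | copair g₁ g₂ => exact coherent_of_inj (injA rfl) _ _ hfg
    | inj c g => exact comp_inj_eq_comp_inj (injB rfl b) hfg hl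
    | proj c g =>
      exact (proj_comp_eq_comp_inj hN (projA rfl c) (injB rfl b)
        (fun x y => (hfg x y).symm) hl').symm

end Coherence

end Dicartesian

/-- Restricted dicartesian coherence: the functor `G` from the free dicartesian category to the
graphical category is faithful on the terms `A → B` with `A` an `O`-normal or `B` an `I`-normal
formula. -/
theorem mainTheorem2 {L : Type u} {A B : Dicartesian.Formula L} (f g : Dicartesian.Term A B)
    (hG : Dicartesian.G.map f.arrow = Dicartesian.G.map g.arrow)
    (hAB : Dicartesian.ONormal A ∨ Dicartesian.INormal B) :
    f.arrow = g.arrow :=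
  Dicartesian.coherent A B hAB _ _ fun x y => by simp only [Dicartesian.Linked, hG]
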